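/- Let $d\ge 1$, $c>0$, $\delta>0$. Let $f,g\in L^\infty(\mathbb R^d)$ have compact (essential) supports $\Omega_f:=\operatorname{supp} f$, $\Omega_g:=\operatorname{supp} g$ of positive Lebesgue measure $|\Omega_f|,|\Omega_g|$, with $f\ge c$ a.e. on $\Omega_f$ and $g\ge c$ a.e. on $\Omega_g$. Put $\Omega:=\Omega_f\times\Omega_g$. Let $C:\mathbb R^d\times\mathbb R^d\to[0,+\infty]$ be finite on $\Omega$ and locally Hölder continuous on $\{C<\infty\}$. For $\theta>0$ and a measurable set $S$ let $L^2_\theta(S)$ be the set of $u\in L^2(S)$ with $u\ge\theta$ a.e. on $S$. For measures $\mu,\nu$ let $F(\mu\mid\nu):=\int\big(\tfrac{d\mu}{d\nu}-1\big)^2d\nu$ if $\mu\ll\nu$ and $F(\mu\mid\nu):=+\infty$ otherwise (Pearson divergence), and for $v\in\{f,g\}$ and $u\ge 0$ on $\operatorname{supp} v$ let $F(u\mid v)$ be the divergence of the measure with density $u$ on $\operatorname{supp} v$ (and $0$ elsewhere) relative to the measure with density $v$. For $k\in L^2(\Omega)$ put $k_x(x):=\int_{\Omega_g}k(x,y)\,dy$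 and $k_y(y):=\int_{\Omega_f}k(x,y)\,dx$. The regularized primal problem is $$d^{\rm reg}_{\delta,C}(f,g):=\inf_{k\in L^2_\delta(\Omega)}\Big\{\int_\Omega C\,k\,dx\,dy+\tfrac12\|k\|_{L^2(\Omega)}^2+\tfrac12F(k_x\mid f)+\tfrac12F(k_y\mid g)\Big\}.\tag{P}$$ With the conjugates $$F^*_\theta(u^*\mid v):=\sup_{u\in L^2_\theta(\operatorname{supp}v)}\Big\{\int_{\operatorname{supp}v}u\,u^*\,dx-F(u\mid v)\Big\},\qquad \bar C^*_\delta(w^*):=\sup_{k\in L^2_\delta(\Omega)}\Big\{\int_\Omega k\,w^*-\int_\Omega C\,k-\tfrac12\|k\|_{L^2(\Omega)}^2\Big\},$$ the dual problem is $$D^{\rm reg}_{\delta,C}(f,g):=\inf_{k_1^*\in L^2(\Omega_f),\;k_2^*\in L^2(\Omega_g)}\Big\{\bar C^*_\delta(k_1^*+k_2^*)+\tfrac12F^*_{\delta|\Omega_g|}(-2k_1^*\mid f)+\tfrac12F^*_{\delta|\Omega_f|}(-2k_2^*\mid g)\Big\},\tag{D}$$ where $(k_1^*+k_2^*)(x,y):=k_1^*(x)+k_2^*(y)$.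 Then: 1. Both (P) and (D) admit minimizers. 2. For $k\in L^2(\Omega)$, $k_1^*\in L^2(\Omega_f)$, $k_2^*\in L^2(\Omega_g)$: $k$ is a minimizer of (P) and $(k_1^*,k_2^*)$ is a minimizer of (D) if and only if, for almost every $x\in\Omega_f$ and $y\in\Omega_g$, $$k(x,y)=\max\{\delta,\;k_1^*(x)+k_2^*(y)-C(x,y)\},$$ $$k_x(x)=f(x)\max\Big\{\frac{\delta|\Omega_g|}{f(x)},\;1-k_1^*(x)\Big\},\qquad k_y(y)=g(y)\max\Big\{\frac{\delta|\Omega_f|}{g(y)},\;1-k_2^*(y)\Big\}.$$ 3. Strong duality holds: $d^{\rm reg}_{\delta,C}(f,g)+D^{\rm reg}_{\delta,C}(f,g)=0$ (in particular both values are finite). -/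

import Mathlib

open MeasureTheory Set Topology
open scoped ENNReal NNReal

noncomputable section

namespace UOT

/-- The Euclidean space `ℝ^d`; `volume` is the Lebesgue measure. -/
abbrev Space (d : ℕ) : Type := EuclideanSpace ℝ (Fin d)

/-- The support of a density `f`, as a function defined up to null sets: the complement of the
largest open set on which `f = 0` almost everywhere, i.e. the support of the measure `|f| 𝓛`. -/
def supp {d : ℕ} (f : Space d → ℝ) : Set (Space d) :=
  (volume.withDensity (fun x => ‖f x‖ₑ)).support

/-- The measure `f 𝓛`, for a nonnegative density `f`. -/
def densityMeasure {d : ℕ} (f : Space d → ℝ) : Measure (Space d) :=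
  volume.withDensity (fun x => ENNReal.ofReal (f x))

/-- `f 𝓛` belongs to the class `𝓜^∞_{𝓛,c}`: `f` is in `L^∞`, has compact support, and is bounded
below by `c` almost everywhere on its support. -/
structure IsAdmissibleDensity {d : ℕ} (c : ℝ) (f : Space d → ℝ) : Prop where
  memLp_top : MemLp f ∞ volume
  isCompact_supp : IsCompact (supp f)
  le_ae : ∀ᵐ x ∂(volume.restrict (supp f)), c ≤ f x

/-- An extended-real-valued cost that is locally Hölder continuous where it is finite. -/
def IsLocallyHolder {d : ℕ} (C : Space d × Space d → ℝ≥0∞) : Prop :=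
  ∀ p, C p ≠ ∞ → ∃ U ∈ 𝓝 p, ∃ L α : ℝ≥0, 0 < α ∧ α ≤ 1 ∧
    HolderOnWith L α (fun q => (C q).toReal) (U ∩ {q | C q ≠ ∞})

/-- The set `L²_θ(S)` of the square-integrable functions on `S` that are at least `θ`
almost everywhere on `S`. -/
def L2ge {X : Type*} [MeasureSpace X] (θ : ℝ) (S : Set X) : Set (X → ℝ) :=
  {u | MemLp u 2 (volume.restrict S) ∧ ∀ᵐ x ∂(volume.restrict S), θ ≤ u x}

open Classical in
/-- The Pearson divergence `F(μ | ν) = ∫ (dμ/dν - 1)² dν` if `μ ≪ ν`, and `+∞` otherwise. -/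
def pearson {X : Type*} [MeasurableSpace X] (μ ν : Measure X) : ℝ≥0∞ :=
  if μ ≪ ν then ∫⁻ x, ENNReal.ofReal (((μ.rnDeriv ν x).toReal - 1) ^ 2) ∂ν else ∞

/-- `F(u | v)` for a nonnegative function `u` on `supp v`: the Pearson divergence of the measure
with density `u` on `supp v` relative to `v 𝓛`. -/
def marginalCost {d : ℕ} (u v : Space d → ℝ) : ℝ≥0∞ :=
  pearson ((volume.restrict (supp v)).withDensity (fun x => ENNReal.ofReal (u x)))
    (densityMeasure v)

/-- `Ω = supp f × supp g`. -/
def Omega {d : ℕ} (f g : Space d → ℝ) : Set (Space d × Space d) := supp f ×ˢ supp g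

/-- The first marginal density `k_x(x) = ∫_{supp g} k(x, y) dy`. -/
def marginalX {d : ℕ} (g : Space d → ℝ) (k : Space d × Space d → ℝ) (x : Space d) : ℝ :=
  ∫ y in supp g, k (x, y)

/-- The second marginal density `k_y(y) = ∫_{supp f} k(x, y) dx`. -/
def marginalY {d : ℕ} (f : Space d → ℝ) (k : Space d × Space d → ℝ) (y : Space d) : ℝ :=
  ∫ x in supp f, k (x, y)

/-- The transport cost `∫_Ω C k`, for `k ≥ 0`. -/
def transportCost {d : ℕ} (C : Space d × Space d → ℝ≥0∞) (f g : Space d → ℝ)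
    (k : Space d × Space d → ℝ) : ℝ≥0∞ :=
  ∫⁻ p in Omega f g, C p * ENNReal.ofReal (k p)

/-- The penalty `‖k‖²_{L²(Ω)}`. -/
def sqNorm {d : ℕ} (f g : Space d → ℝ) (k : Space d × Space d → ℝ) : ℝ≥0∞ :=
  eLpNorm k 2 (volume.restrict (Omega f g)) ^ 2

/-- The objective `∫_Ω C k + ½ ‖k‖² + ½ F(k_x | f) + ½ F(k_y | g)` of the regularized primal
problem. -/
def primalObjective {d : ℕ} (C : Space d × Space d → ℝ≥0∞) (f g : Space d → ℝ)
    (k : Space d × Space d → ℝ) : ℝ≥0∞ :=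
  transportCost C f g k + 1 / 2 * sqNorm f g k
    + 1 / 2 * marginalCost (marginalX g k) f + 1 / 2 * marginalCost (marginalY f k) g

/-- The optimal value `d^reg_{δ,C}(f, g)` of the regularized primal problem. -/
def primalValue {d : ℕ} (δ : ℝ) (C : Space d × Space d → ℝ≥0∞) (f g : Space d → ℝ) : ℝ≥0∞ :=
  ⨅ k ∈ L2ge δ (Omega f g), primalObjective C f g k

/-- `k` is a minimizer of the regularized primal problem. -/
def IsPrimalMinimizer {d : ℕ} (δ : ℝ) (C : Space d × Space d → ℝ≥0∞) (f g : Space d → ℝ)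
    (k : Space d × Space d → ℝ) : Prop :=
  k ∈ L2ge δ (Omega f g) ∧ IsMinOn (primalObjective C f g) (L2ge δ (Omega f g)) k

/-- The conjugate `F*_θ(u* | v) = sup { ∫_{supp v} u u* - F(u | v) : u ∈ L²_θ(supp v) }`. -/
def conjF {d : ℕ} (θ : ℝ) (ustar v : Space d → ℝ) : EReal :=
  ⨆ u ∈ L2ge θ (supp v),
    ((∫ x in supp v, u x * ustar x : ℝ) : EReal) - (marginalCost u v : EReal)

/-- The conjugate `C̄*_δ(w*) = sup { ∫_Ω k w* - ∫_Ω C k - ½ ‖k‖² : k ∈ L²_δ(Ω) }`. -/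
def conjC {d : ℕ} (δ : ℝ) (C : Space d × Space d → ℝ≥0∞) (f g : Space d → ℝ)
    (wstar : Space d × Space d → ℝ) : EReal :=
  ⨆ k ∈ L2ge δ (Omega f g),
    ((∫ p in Omega f g, k p * wstar p : ℝ) : EReal) - (transportCost C f g k : EReal)
      - ((1 / 2 * sqNorm f g k : ℝ≥0∞) : EReal)

/-- The dual variables `(k₁*, k₂*) ∈ L²(supp f) × L²(supp g)`. -/
def dualSpace {d : ℕ} (f g : Space d → ℝ) : Set ((Space d → ℝ) × (Space d → ℝ)) :=
  {q | MemLp q.1 2 (volume.restrict (supp f)) ∧ MemLp q.2 2 (volume.restrict (supp g))}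

/-- The objective
`C̄*_δ(k₁* + k₂*) + ½ F*_{δ|supp g|}(-2 k₁* | f) + ½ F*_{δ|supp f|}(-2 k₂* | g)` of the
dual problem. -/
def dualObjective {d : ℕ} (δ : ℝ) (C : Space d × Space d → ℝ≥0∞) (f g : Space d → ℝ)
    (q : (Space d → ℝ) × (Space d → ℝ)) : EReal :=
  conjC δ C f g (fun p => q.1 p.1 + q.2 p.2)
    + ((1 / 2 : ℝ) : EReal) * conjF (δ * volume.real (supp g)) (fun x => -2 * q.1 x) f
    + ((1 / 2 : ℝ) : EReal) * conjF (δ * volume.real (supp f)) (fun y => -2 * q.2 y) g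

/-- The optimal value `D^reg_{δ,C}(f, g)` of the dual problem. -/
def dualValue {d : ℕ} (δ : ℝ) (C : Space d × Space d → ℝ≥0∞) (f g : Space d → ℝ) : EReal :=
  ⨅ q ∈ dualSpace f g, dualObjective δ C f g q

/-- `q = (k₁*, k₂*)` is a minimizer of the dual problem. -/
def IsDualMinimizer {d : ℕ} (δ : ℝ) (C : Space d × Space d → ℝ≥0∞) (f g : Space d → ℝ)
    (q : (Space d → ℝ) × (Space d → ℝ)) : Prop :=
  q ∈ dualSpace f g ∧ IsMinOn (dualObjective δ C f g) (dualSpace f g) q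

end UOT

end

/-!
The problem is a convex quadratic program in `L²(Ω)`, and the whole theorem is read off from the
equality case of weak duality together with the solvability of the optimality system.

*Conjugates.* Both conjugates are suprema of integrals of concave quadratics
`t ↦ t s - t² / (2 r)` over `t ≥ θ`, with `r = 1` and `s = k₁ + k₂ - C` for the transport cost, and
with `r = f`, `s = 1 - k₁` (up to a constant) for half of the Pearson penalty, since
`-t k₁ - (t - f)² / (2 f) = t (1 - k₁) - t² / (2 f) - f / 2`. The pointwise maximizer is
`max θ (r s)`, it belongs to the admissible class, and by strong concavity it is the only one up to
null sets (`integral_quadGain_eq_iff`). So every conjugate is finite and attained at that point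
(`conjF_eq`, `conjC_eq`).

*Duality gap.* By Fubini, `∫_Ω k (k₁ + k₂)` is the sum of the pairings of the marginals with `k₁`
and `k₂`. Hence the sum of the primal and dual objectives is a sum of three nonnegative gaps, and it
vanishes exactly when `k`, `k_x` and `k_y` are the three pointwise maximizers, that is, when the
optimality system holds (`exists_real_objectives`). A solution of the system is therefore a pair of
minimizers with zero gap.

*Solvability.* Up to a constant, the primal objective is half the squared distance of
`(k, k_x / √f, k_y / √g)` from `(-C, √f, √g)` in a product of `L²` spaces, so a minimizer `k` is
given by a projection onto a closed convex set (`exists_variational_inequality`). With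
`k₁ = 1 - k_x / f` and `k₂ = 1 - k_y / g` the variational inequality says that
`∫_Ω (k - s) (h - k) ≥ 0` for all `h ≥ δ`, where `s = k₁ + k₂ - C`, which forces `k = max δ s`
(`exists_eq_quadArgmax`). The marginal equations hold by the choice of `k₁`, `k₂`, because
`k ≥ δ` gives `k_x ≥ δ |Ω_g|` and `k_y ≥ δ |Ω_f|`. In particular the dual problem has a minimizer,
although its objective is not strictly convex.
-/

noncomputable section

namespace UOT

/-! ### Pointwise maximization of a concave quadratic over a half-line -/

/-- A measurable weight that is essentially bounded and essentially bounded away from zero. -/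
structure IsWeight {X : Type*} [MeasurableSpace X] (μ : Measure X) (r : X → ℝ) : Prop where
  aestronglyMeasurable : AEStronglyMeasurable r μ
  exists_pos_le : ∃ m : ℝ, 0 < m ∧ ∀ᵐ x ∂μ, m ≤ r x
  exists_le : ∃ M : ℝ, ∀ᵐ x ∂μ, r x ≤ M

section Quadratic

variable {X : Type*} [MeasurableSpace X] {μ : Measure X} {r s u : X → ℝ} {θ : ℝ}

lemma IsWeight.one : IsWeight μ (fun _ => (1 : ℝ)) :=
  ⟨aestronglyMeasurable_const, ⟨1, one_pos, ae_of_all _ fun _ => le_rfl⟩,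
    ⟨1, ae_of_all _ fun _ => le_rfl⟩⟩

lemma IsWeight.pos (hr : IsWeight μ r) : ∀ᵐ x ∂μ, 0 < r x := by
  obtain ⟨m, hm, h⟩ := hr.exists_pos_le
  filter_upwards [h] with x hx using hm.trans_le hx

lemma IsWeight.memLp_mul (hr : IsWeight μ r) (hs : MemLp s 2 μ) :
    MemLp (fun x => r x * s x) 2 μ := by
  obtain ⟨M, hM⟩ := hr.exists_le
  refine hs.of_le_mul (c := M) (hr.aestronglyMeasurable.mul hs.aestronglyMeasurable) ?_
  filter_upwards [hM, hr.pos] with x hx h0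
  rw [norm_mul, Real.norm_of_nonneg h0.le]
  gcongr

lemma IsWeight.memLp_div (hr : IsWeight μ r) (hs : MemLp s 2 μ) :
    MemLp (fun x => s x / r x) 2 μ := by
  obtain ⟨m, hm, h⟩ := hr.exists_pos_le
  refine hs.of_le_mul (c := m⁻¹)
    (hs.aestronglyMeasurable.aemeasurable.div
      hr.aestronglyMeasurable.aemeasurable).aestronglyMeasurable ?_
  filter_upwards [h, hr.pos] with x hx h0
  rw [norm_div, Real.norm_of_nonneg h0.le, div_eq_inv_mul]
  gcongr

lemma IsWeight.memLp [IsFiniteMeasure μ] (hr : IsWeight μ r) : MemLp r 2 μ := by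
  simpa using hr.memLp_mul (memLp_const (1 : ℝ))

/-- The concave quadratic `u ↦ u s - u² / (2 r)`, evaluated pointwise. -/
def quadGain (r s u : X → ℝ) (x : X) : ℝ := u x * s x - u x ^ 2 / (2 * r x)

/-- The pointwise maximizer `max θ (r s)` of `quadGain r s` over `[θ, ∞)`. -/
def quadArgmax (θ : ℝ) (r s : X → ℝ) (x : X) : ℝ := max θ (r x * s x)

lemma integrable_quadGain (hr : IsWeight μ r) (hs : MemLp s 2 μ) (hu : MemLp u 2 μ) :
    Integrable (quadGain r s u) μ := by
  have h1 : Integrable (fun x => u x * s x) μ := hu.integrable_mul hs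
  have h2 : Integrable (fun x => u x * (u x / r x)) μ := hu.integrable_mul (hr.memLp_div hu)
  refine (h1.sub (h2.const_mul (1 / 2))).congr (ae_of_all _ fun x => ?_)
  simp only [quadGain, Pi.sub_apply]
  ring

lemma memLp_quadArgmax [IsFiniteMeasure μ] (hr : IsWeight μ r) (hs : MemLp s 2 μ) :
    MemLp (quadArgmax θ r s) 2 μ :=
  (memLp_const θ).sup (hr.memLp_mul hs)

/-- Strong concavity: the loss at `a` is at least half the weighted squared distance of `a` to
the maximizer, because the derivative at the maximizer points outwards. -/
lemma quadGain_add_sq_le {θ a s r : ℝ} (hr : 0 < r) (ha : θ ≤ a) :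
    a * s - a ^ 2 / (2 * r) + (max θ (r * s) - a) ^ 2 / (2 * r)
      ≤ max θ (r * s) * s - max θ (r * s) ^ 2 / (2 * r) := by
  have key : 0 ≤ (max θ (r * s) - a) * (r * s - max θ (r * s)) := by
    rcases le_total θ (r * s) with h | h
    · simp [max_eq_right h]
    · rw [max_eq_left h]
      exact mul_nonneg_of_nonpos_of_nonpos (by linarith) (by linarith)
  generalize max θ (r * s) = m at key ⊢
  have : (m * s - m ^ 2 / (2 * r)) - (a * s - a ^ 2 / (2 * r) + (m - a) ^ 2 / (2 * r))
      = (m - a) * (r * s - m) / r := by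
    field_simp
    ring
  have h2 := div_nonneg key hr.le
  linarith

lemma ae_quadGain_le (hr : IsWeight μ r) (hθ : ∀ᵐ x ∂μ, θ ≤ u x) :
    quadGain r s u ≤ᵐ[μ] quadGain r s (quadArgmax θ r s) := by
  filter_upwards [hr.pos, hθ] with x hx hu
  have := quadGain_add_sq_le (s := s x) hx hu
  have h2 : 0 ≤ (max θ (r x * s x) - u x) ^ 2 / (2 * r x) := by positivity
  simp only [quadGain, quadArgmax]
  linarith

variable [IsFiniteMeasure μ]

lemma integral_quadGain_le (hr : IsWeight μ r) (hs : MemLp s 2 μ) (hu : MemLp u 2 μ)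
    (hθ : ∀ᵐ x ∂μ, θ ≤ u x) :
    ∫ x, quadGain r s u x ∂μ ≤ ∫ x, quadGain r s (quadArgmax θ r s) x ∂μ :=
  integral_mono_ae (integrable_quadGain hr hs hu)
    (integrable_quadGain hr hs (memLp_quadArgmax hr hs)) (ae_quadGain_le hr hθ)

lemma integral_quadGain_eq_iff (hr : IsWeight μ r) (hs : MemLp s 2 μ) (hu : MemLp u 2 μ)
    (hθ : ∀ᵐ x ∂μ, θ ≤ u x) :
    ∫ x, quadGain r s u x ∂μ = ∫ x, quadGain r s (quadArgmax θ r s) x ∂μ ↔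
      u =ᵐ[μ] quadArgmax θ r s := by
  rw [integral_eq_iff_of_ae_le (integrable_quadGain hr hs hu)
    (integrable_quadGain hr hs (memLp_quadArgmax hr hs)) (ae_quadGain_le hr hθ)]
  constructor
  · intro h
    filter_upwards [hr.pos, hθ, h] with x hx hu h
    -- Equality of the gains leaves no room for the quadratic loss.
    have := quadGain_add_sq_le (s := s x) hx hu
    simp only [quadGain, quadArgmax] at h ⊢
    have h2 : (max θ (r x * s x) - u x) ^ 2 / (2 * r x) ≤ 0 := by linarith
    rw [div_le_iff₀ (by positivity), zero_mul] at h2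
    have := pow_eq_zero_iff (two_ne_zero) |>.1 (le_antisymm h2 (sq_nonneg _))
    linarith
  · intro h
    filter_upwards [h] with x hx
    simp only [quadGain, hx]

end Quadratic

/-! ### Marginals of square-integrable functions -/

section Marginal

variable {X Y : Type*} [MeasurableSpace X] [MeasurableSpace Y] {μ : Measure X} {ν : Measure Y}
  [IsFiniteMeasure ν] {k : X × Y → ℝ}

/-- Cauchy–Schwarz in the second variable. -/
lemma eLpNorm_integral_snd_le (hk : AEStronglyMeasurable k (μ.prod ν)) :
    eLpNorm (fun x => ∫ y, k (x, y) ∂ν) 2 μ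
      ≤ ν univ ^ (1 / 2 : ℝ) * eLpNorm k 2 (μ.prod ν) := by
  have key : ∀ᵐ x ∂μ, ‖∫ y, k (x, y) ∂ν‖ₑ ^ (2 : ℝ)
      ≤ ν univ * ∫⁻ y, ‖k (x, y)‖ₑ ^ (2 : ℝ) ∂ν := by
    filter_upwards [hk.prodMk_left] with x hx
    have h1 := eLpNorm_le_eLpNorm_mul_rpow_measure_univ (p := 1) (q := 2) (by norm_num) hx
    rw [eLpNorm_one_eq_lintegral_enorm,
      eLpNorm_eq_lintegral_rpow_enorm_toReal (by norm_num) (by norm_num)] at h1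
    have h2 := (enorm_integral_le_lintegral_enorm _).trans h1
    have h3 := ENNReal.rpow_le_rpow h2 (z := 2) (by norm_num)
    refine h3.trans (le_of_eq ?_)
    rw [ENNReal.mul_rpow_of_nonneg _ _ (by norm_num), ← ENNReal.rpow_mul, ← ENNReal.rpow_mul,
      mul_comm]
    norm_num
  rw [eLpNorm_eq_lintegral_rpow_enorm_toReal (by norm_num) (by norm_num),
    eLpNorm_eq_lintegral_rpow_enorm_toReal (by norm_num) (by norm_num)]
  simp only [ENNReal.toReal_ofNat]
  rw [← ENNReal.mul_rpow_of_nonneg _ _ (by norm_num)]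
  gcongr
  rw [lintegral_prod _ (by fun_prop), ← lintegral_const_mul'' _ (by fun_prop)]
  exact lintegral_mono_ae key

lemma memLp_integral_snd (hk : MemLp k 2 (μ.prod ν)) :
    MemLp (fun x => ∫ y, k (x, y) ∂ν) 2 μ :=
  ⟨hk.aestronglyMeasurable.integral_prod_right', (eLpNorm_integral_snd_le
    hk.aestronglyMeasurable).trans_lt (ENNReal.mul_lt_top (by finiteness) hk.eLpNorm_lt_top)⟩

variable [IsFiniteMeasure μ]

lemma memLp_integral_fst (hk : MemLp k 2 (μ.prod ν)) :
    MemLp (fun y => ∫ x, k (x, y) ∂μ) 2 ν :=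
  memLp_integral_snd (k := k ∘ Prod.swap)
    (hk.comp_measurePreserving Measure.measurePreserving_swap)

lemma le_integral_snd {δ : ℝ} (hk : Integrable k (μ.prod ν)) (h : ∀ᵐ p ∂μ.prod ν, δ ≤ k p) :
    ∀ᵐ x ∂μ, δ * ν.real univ ≤ ∫ y, k (x, y) ∂ν := by
  filter_upwards [hk.prod_right_ae, Measure.ae_ae_of_ae_prod h] with x hx hδ
  have := integral_mono_ae (integrable_const δ) hx hδ
  rwa [integral_const, smul_eq_mul, mul_comm] at this

lemma le_integral_fst {δ : ℝ} (hk : Integrable k (μ.prod ν)) (h : ∀ᵐ p ∂μ.prod ν, δ ≤ k p) :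
    ∀ᵐ y ∂ν, δ * μ.real univ ≤ ∫ x, k (x, y) ∂μ :=
  le_integral_snd (k := k ∘ Prod.swap) hk.swap
    (Measure.measurePreserving_swap.quasiMeasurePreserving.ae h)

lemma integral_mul_fst {a : X → ℝ} (hk : MemLp k 2 (μ.prod ν)) (ha : MemLp a 2 μ) :
    ∫ p, k p * a p.1 ∂μ.prod ν = ∫ x, (∫ y, k (x, y) ∂ν) * a x ∂μ := by
  rw [integral_prod (fun p => k p * a p.1) (hk.integrable_mul (ha.comp_fst ν))]
  simp only [integral_mul_const]

lemma integral_mul_snd {b : Y → ℝ} (hk : MemLp k 2 (μ.prod ν)) (hb : MemLp b 2 ν) :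
    ∫ p, k p * b p.2 ∂μ.prod ν = ∫ y, (∫ x, k (x, y) ∂μ) * b y ∂ν := by
  rw [integral_prod_symm (fun p => k p * b p.2) (hk.integrable_mul (hb.comp_snd μ))]
  simp only [integral_mul_const]

/-- The weighted marginal `k ↦ w(x) ∫ k(x, y) dν(y)` is a bounded operator on `L²`. -/
lemma exists_marginalCLM {w : X → ℝ} (hw : IsWeight μ w) :
    ∃ A : Lp ℝ 2 (μ.prod ν) →L[ℝ] Lp ℝ 2 μ,
      ∀ k, A k =ᵐ[μ] fun x => w x * ∫ y, k (x, y) ∂ν := by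
  have hmem (k : Lp ℝ 2 (μ.prod ν)) : MemLp (fun x => w x * ∫ y, k (x, y) ∂ν) 2 μ :=
    hw.memLp_mul (memLp_integral_snd (Lp.memLp k))
  have hint (k : Lp ℝ 2 (μ.prod ν)) : ∀ᵐ x ∂μ, Integrable (fun y => k (x, y)) ν :=
    ((Lp.memLp k).integrable one_le_two).prod_right_ae
  let A : Lp ℝ 2 (μ.prod ν) →ₗ[ℝ] Lp ℝ 2 μ :=
    { toFun := fun k => (hmem k).toLp _
      map_add' := fun k h => by
        rw [← MemLp.toLp_add, MemLp.toLp_eq_toLp_iff]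
        filter_upwards [hint k, hint h, Measure.ae_ae_of_ae_prod (Lp.coeFn_add k h)]
          with x hk hh hkh
        rw [Pi.add_apply, integral_congr_ae hkh, ← mul_add, ← integral_add hk hh]
        rfl
      map_smul' := fun t k => by
        rw [RingHom.id_apply, ← MemLp.toLp_const_smul, MemLp.toLp_eq_toLp_iff]
        filter_upwards [Measure.ae_ae_of_ae_prod (Lp.coeFn_smul t k)] with x hk
        rw [Pi.smul_apply, integral_congr_ae hk]
        simp only [Pi.smul_apply, smul_eq_mul, integral_const_mul]
        ring }
  obtain ⟨M, hM⟩ := hw.exists_le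
  refine ⟨A.mkContinuous (max M 0 * (ν univ ^ (1 / 2 : ℝ)).toReal) fun k => ?_,
    fun k => (hmem k).coeFn_toLp⟩
  change ‖(hmem k).toLp _‖ ≤ _
  rw [Lp.norm_toLp, Lp.norm_def, mul_assoc, ← ENNReal.toReal_mul,
    ← ENNReal.toReal_ofReal (le_max_right M 0), ← ENNReal.toReal_mul]
  refine ENNReal.toReal_mono ?_ ?_
  · exact ENNReal.mul_ne_top (by finiteness)
      (ENNReal.mul_ne_top (by finiteness) (Lp.memLp k).eLpNorm_ne_top)
  · refine le_trans ?_ (mul_le_mul_right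
      (eLpNorm_integral_snd_le (Lp.memLp k).aestronglyMeasurable) _)
    refine eLpNorm_le_mul_eLpNorm_of_ae_le_mul ?_ 2
    filter_upwards [hM, hw.pos] with x hx h0
    rw [norm_mul, Real.norm_of_nonneg h0.le]
    gcongr
    exact hx.trans (le_max_left _ _)

end Marginal

/-! ### Solvability of the optimality system -/

open scoped RealInnerProductSpace in
/-- First-order condition for the minimization of `‖k - c‖² + ‖A k - a‖² + ‖B k - b‖²` over a
closed convex set `K`: the minimizer corresponds to the projection of `(c, a, b)` onto the graph
of `(A, B)` over `K`. -/
lemma exists_variational_inequality {H E F : Type*}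
    [NormedAddCommGroup H] [InnerProductSpace ℝ H] [CompleteSpace H]
    [NormedAddCommGroup E] [InnerProductSpace ℝ E] [NormedAddCommGroup F] [InnerProductSpace ℝ F]
    (A : H →L[ℝ] E) (B : H →L[ℝ] F) (c : H) (a : E) (b : F) {K : Set H}
    (hne : K.Nonempty) (hclosed : IsClosed K) (hconv : Convex ℝ K) :
    ∃ k ∈ K, ∀ h ∈ K,
      0 ≤ ⟪k - c, h - k⟫ + ⟪A k - a, A h - A k⟫ + ⟪B k - b, B h - B k⟫ := by
  let T : H →L[ℝ] WithLp 2 (H × WithLp 2 (E × F)) :=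
    (WithLp.prodContinuousLinearEquiv 2 ℝ H (WithLp 2 (E × F))).symm.toContinuousLinearMap ∘L
      ((ContinuousLinearMap.id ℝ H).prod
        ((WithLp.prodContinuousLinearEquiv 2 ℝ E F).symm.toContinuousLinearMap ∘L (A.prod B)))
  have hT (k : H) : T k = WithLp.toLp 2 (k, WithLp.toLp 2 (A k, B k)) := rfl
  have hanti : AntilipschitzWith 1 T := by
    refine AddMonoidHomClass.antilipschitz_of_bound T fun x => ?_
    rw [NNReal.coe_one, one_mul, hT]
    exact WithLp.norm_fst_le (x := WithLp.toLp 2 (x, WithLp.toLp 2 (A x, B x)))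
  have hcomplete : IsComplete (T '' K) :=
    (hanti.isUniformInducing T.uniformContinuous).isComplete_iff.2 hclosed.isComplete
  have hTconv : Convex ℝ (T '' K) := hconv.linear_image T.toLinearMap
  obtain ⟨v, hv, hmin⟩ := exists_norm_eq_iInf_of_complete_convex (hne.image T) hcomplete hTconv
    (WithLp.toLp 2 (c, WithLp.toLp 2 (a, b)))
  obtain ⟨k, hk, rfl⟩ := hv
  refine ⟨k, hk, fun h hh => ?_⟩
  have := (norm_eq_iInf_iff_real_inner_le_zero hTconv ⟨k, hk, rfl⟩).1 hmin (T h) ⟨h, hh, rfl⟩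
  rw [hT, hT] at this
  simp only [WithLp.prod_inner_apply, ← WithLp.toLp_sub, Prod.mk_sub_mk] at this
  rw [← neg_sub c k, ← neg_sub a (A k), ← neg_sub b (B k), inner_neg_left, inner_neg_left,
    inner_neg_left]
  linarith

section Existence

variable {X Y : Type*} [MeasurableSpace X] [MeasurableSpace Y] {μ : Measure X} {ν : Measure Y}

lemma IsWeight.inv_sqrt {r : X → ℝ} (hr : IsWeight μ r) :
    IsWeight μ (fun x => (√(r x))⁻¹) := by
  obtain ⟨m, hm, h⟩ := hr.exists_pos_le
  obtain ⟨M, hM⟩ := hr.exists_le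
  refine ⟨(hr.aestronglyMeasurable.aemeasurable.sqrt.inv).aestronglyMeasurable,
    ⟨(√(max M 1))⁻¹, by positivity, ?_⟩, ⟨(√m)⁻¹, ?_⟩⟩
  · filter_upwards [hM, hr.pos] with x hx h0
    gcongr
    exact hx.trans (le_max_left _ _)
  · filter_upwards [h, hr.pos] with x hx h0
    gcongr

variable [IsFiniteMeasure μ] [IsFiniteMeasure ν]

/-- Solvability of the optimality system. The dual variables are eliminated through
`k₁ = 1 - k_x / f` and `k₂ = 1 - k_y / g`. -/
theorem exists_eq_quadArgmax {f : X → ℝ} {g : Y → ℝ} {C : X × Y → ℝ} (δ : ℝ)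
    (hf : IsWeight μ f) (hg : IsWeight ν g) (hC : MemLp C 2 (μ.prod ν)) :
    ∃ k : X × Y → ℝ, MemLp k 2 (μ.prod ν) ∧ (∀ᵐ p ∂μ.prod ν, δ ≤ k p) ∧
      k =ᵐ[μ.prod ν] quadArgmax δ (fun _ => 1) (fun p =>
        (1 - (∫ y, k (p.1, y) ∂ν) / f p.1) + (1 - (∫ x, k (x, p.2) ∂μ) / g p.2) - C p) := by
  obtain ⟨A, hA⟩ := exists_marginalCLM (ν := ν) hf.inv_sqrt
  obtain ⟨B', hB'⟩ := exists_marginalCLM (ν := μ) hg.inv_sqrt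
  let σ := Lp.compMeasurePreservingₗᵢ ℝ (E := ℝ) (p := 2) (Prod.swap : Y × X → X × Y)
    (Measure.measurePreserving_swap (μ := ν) (ν := μ))
  let B := B' ∘L σ.toContinuousLinearMap
  have hB (k : Lp ℝ 2 (μ.prod ν)) :
      B k =ᵐ[ν] fun y => (√(g y))⁻¹ * ∫ x, k (x, y) ∂μ := by
    have h1 : (σ k : Y × X → ℝ) =ᵐ[ν.prod μ] k ∘ Prod.swap :=
      Lp.coeFn_compMeasurePreserving k Measure.measurePreserving_swap
    filter_upwards [hB' (σ k), Measure.ae_ae_of_ae_prod h1] with y hy hy'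
    rw [show B k = B' (σ k) from rfl, hy, integral_congr_ae hy']
    rfl
  let a : Lp ℝ 2 μ := (hf.inv_sqrt.memLp_mul hf.memLp).toLp _
  let b : Lp ℝ 2 ν := (hg.inv_sqrt.memLp_mul hg.memLp).toLp _
  let d : Lp ℝ 2 (μ.prod ν) := (memLp_const δ).toLp _
  have hge (h : Lp ℝ 2 (μ.prod ν)) : d ≤ h ↔ ∀ᵐ p ∂μ.prod ν, δ ≤ h p := by
    rw [← Lp.coeFn_le]
    have hd : d =ᵐ[μ.prod ν] fun _ => δ := (memLp_const δ).coeFn_toLp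
    exact Filter.eventually_congr (by filter_upwards [hd] with p hp; rw [hp])
  have hconv : Convex ℝ (Ici d) := fun x hx y hy t u ht hu htu => by
    refine (hge _).2 ?_
    filter_upwards [(hge x).1 hx, (hge y).1 hy, Lp.coeFn_add (t • x) (u • y),
      Lp.coeFn_smul t x, Lp.coeFn_smul u y] with p h1 h2 h3 h4 h5
    rw [h3, Pi.add_apply, h4, h5]
    exact convex_Ici δ h1 h2 ht hu htu
  obtain ⟨k, hk, hvar⟩ := exists_variational_inequality A B (-hC.toLp C) a b (K := Ici d)
    nonempty_Ici isClosed_Ici hconv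
  have hkge := (hge k).1 hk
  have hkm := Lp.memLp k
  refine ⟨k, hkm, hkge, ?_⟩
  set k₁ : X → ℝ := fun x => 1 - (∫ y, k (x, y) ∂ν) / f x with hk₁
  set k₂ : Y → ℝ := fun y => 1 - (∫ x, k (x, y) ∂μ) / g y with hk₂
  have hk₁m : MemLp k₁ 2 μ := (memLp_const 1).sub (hf.memLp_div (memLp_integral_snd hkm))
  have hk₂m : MemLp k₂ 2 ν := (memLp_const 1).sub (hg.memLp_div (memLp_integral_fst hkm))
  set s : X × Y → ℝ := fun p => k₁ p.1 + k₂ p.2 - C p with hs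
  have hsm : MemLp s 2 (μ.prod ν) := ((hk₁m.comp_fst ν).add (hk₂m.comp_snd μ)).sub hC
  change k =ᵐ[μ.prod ν] quadArgmax δ (fun _ => 1) s
  have hm : MemLp (quadArgmax δ (fun _ => 1) s) 2 (μ.prod ν) := memLp_quadArgmax .one hsm
  refine (integral_quadGain_eq_iff .one hsm hkm hkge).1
    (le_antisymm (integral_quadGain_le .one hsm hkm hkge) ?_)
  -- The variational inequality is tested with the maximizer `h` of the concave quadratic.
  set h := quadArgmax δ (fun _ => 1) s with hh
  have hdm : MemLp (fun p => h p - k p) 2 (μ.prod ν) := hm.sub hkm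
  have hH : hm.toLp h =ᵐ[μ.prod ν] h := hm.coeFn_toLp
  have hv := hvar (hm.toLp h) ((hge _).2 (by
    filter_upwards [hH] with p hp
    rw [hp]
    exact le_max_left _ _))
  have e0 : inner ℝ (k - -hC.toLp C) (hm.toLp h - k)
      = ∫ p, (h p - k p) * (k p + C p) ∂μ.prod ν := by
    rw [L2.inner_def]
    refine integral_congr_ae ?_
    filter_upwards [hH, hC.coeFn_toLp, Lp.coeFn_sub (hm.toLp h) k,
      Lp.coeFn_add k (hC.toLp C)] with p h1 h2 h3 h4
    rw [sub_neg_eq_add, h3, h4]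
    simp [h1, h2]
  -- The weight `1 / √f` enters both factors, so their product carries `(k_x - f) / f = -k₁`.
  have e1 : inner ℝ (A k - a) (A (hm.toLp h) - A k)
      = -∫ p, (h p - k p) * k₁ p.1 ∂μ.prod ν := by
    rw [integral_mul_fst hdm hk₁m, L2.inner_def, ← integral_neg]
    refine integral_congr_ae ?_
    filter_upwards [hA k, hA (hm.toLp h), (hf.inv_sqrt.memLp_mul hf.memLp).coeFn_toLp,
      Lp.coeFn_sub (A k) a, Lp.coeFn_sub (A (hm.toLp h)) (A k), Measure.ae_ae_of_ae_prod hH,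
      (hkm.integrable one_le_two).prod_right_ae, (hm.integrable one_le_two).prod_right_ae,
      hf.pos] with x h1 h2 h3 h4 h5 h6 h7 h8 h9
    rw [h4, h5, Pi.sub_apply, Pi.sub_apply, h1, h2, h3, integral_congr_ae h6,
      integral_sub h8 h7, hk₁]
    have h10 := Real.mul_self_sqrt h9.le
    have h11 := Real.sqrt_pos.2 h9
    simp only [RCLike.inner_apply, conj_trivial]
    generalize ∫ y, k (x, y) ∂ν = u
    generalize ∫ y, h (x, y) ∂ν = w
    generalize √(f x) = t at *
    rw [← h10]
    field_simp
    ring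
  have e2 : inner ℝ (B k - b) (B (hm.toLp h) - B k)
      = -∫ p, (h p - k p) * k₂ p.2 ∂μ.prod ν := by
    have hH' : ∀ᵐ y ∂ν, ∀ᵐ x ∂μ, hm.toLp h (x, y) = h (x, y) :=
      Measure.ae_ae_of_ae_prod
        (Measure.measurePreserving_swap.quasiMeasurePreserving.ae hH)
    rw [integral_mul_snd hdm hk₂m, L2.inner_def, ← integral_neg]
    refine integral_congr_ae ?_
    filter_upwards [hB k, hB (hm.toLp h), (hg.inv_sqrt.memLp_mul hg.memLp).coeFn_toLp,
      Lp.coeFn_sub (B k) b, Lp.coeFn_sub (B (hm.toLp h)) (B k), hH',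
      (hkm.integrable one_le_two).prod_left_ae, (hm.integrable one_le_two).prod_left_ae,
      hg.pos] with y h1 h2 h3 h4 h5 h6 h7 h8 h9
    rw [h4, h5, Pi.sub_apply, Pi.sub_apply, h1, h2, h3, integral_congr_ae h6,
      integral_sub h8 h7, hk₂]
    have h10 := Real.mul_self_sqrt h9.le
    have h11 := Real.sqrt_pos.2 h9
    simp only [RCLike.inner_apply, conj_trivial]
    generalize ∫ x, k (x, y) ∂μ = u
    generalize ∫ x, h (x, y) ∂μ = w
    generalize √(g y) = t at *
    rw [← h10]
    field_simp
    ring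
  rw [e0, e1, e2] at hv
  have i0 : Integrable (fun p => (h p - k p) * (k p + C p)) (μ.prod ν) :=
    hdm.integrable_mul (hkm.add hC)
  have i1 : Integrable (fun p => (h p - k p) * k₁ p.1) (μ.prod ν) :=
    hdm.integrable_mul (hk₁m.comp_fst ν)
  have i2 : Integrable (fun p => (h p - k p) * k₂ p.2) (μ.prod ν) :=
    hdm.integrable_mul (hk₂m.comp_snd μ)
  have hgap : 0 ≤ ∫ p, ((h p - k p) * (k p + C p) - (h p - k p) * k₁ p.1
      - (h p - k p) * k₂ p.2) ∂μ.prod ν := by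
    have e3 := integral_sub (i0.sub i1) i2
    have e4 := integral_sub i0 i1
    simp only [Pi.sub_apply] at e3 e4
    rw [e3, e4]
    linarith
  rw [← sub_nonneg, ← integral_sub (integrable_quadGain .one hsm hkm)
    (integrable_quadGain .one hsm hm)]
  refine hgap.trans (integral_mono ((i0.sub i1).sub i2)
    ((integrable_quadGain .one hsm hkm).sub (integrable_quadGain .one hsm hm)) fun p => ?_)
  -- The integrands differ by `(h - k)² / 2`.
  simp only [quadGain, hs]
  nlinarith [sq_nonneg (h p - k p)]

end Existence

/-! ### Real-valued formulas for the penalties -/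

section Formulas

variable {d : ℕ} {c δ θ : ℝ} {f g v u k₁ k₂ : Space d → ℝ} {C : Space d × Space d → ℝ≥0∞}
  {k w : Space d × Space d → ℝ}

lemma coe_ennreal_ofReal_of_nonneg {x : ℝ} (hx : 0 ≤ x) :
    ((ENNReal.ofReal x : ℝ≥0∞) : EReal) = (x : EReal) := by
  rw [EReal.coe_ennreal_ofReal, max_eq_left hx]

lemma measurableSet_supp : MeasurableSet (supp v) :=
  Measure.isClosed_support.measurableSet

lemma IsAdmissibleDensity.isFiniteMeasure (hv : IsAdmissibleDensity c v) :
    IsFiniteMeasure (volume.restrict (supp v)) :=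
  ⟨by simpa using hv.isCompact_supp.measure_lt_top⟩

lemma IsAdmissibleDensity.isWeight (hc : 0 < c) (hv : IsAdmissibleDensity c v) :
    IsWeight (volume.restrict (supp v)) v := by
  refine ⟨hv.memLp_top.aestronglyMeasurable.restrict, ⟨c, hc, hv.le_ae⟩,
    ⟨lpNorm v ∞ volume, ?_⟩⟩
  filter_upwards [ae_restrict_of_ae (ae_le_lpNorm_exponent_top hv.memLp_top)] with x hx
  exact (le_abs_self _).trans hx

lemma IsAdmissibleDensity.densityMeasure_eq (hv : IsAdmissibleDensity c v) :
    densityMeasure v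
      = (volume.restrict (supp v)).withDensity (fun x => ENNReal.ofReal (v x)) := by
  have h : (volume.withDensity (fun x => ‖v x‖ₑ)) (supp v)ᶜ = 0 := Measure.measure_compl_support
  rw [withDensity_apply _ measurableSet_supp.compl,
    lintegral_eq_zero_iff' hv.memLp_top.aestronglyMeasurable.enorm.restrict,
    Filter.EventuallyEq, ae_restrict_iff' measurableSet_supp.compl] at h
  rw [densityMeasure, ← withDensity_indicator measurableSet_supp]
  refine withDensity_congr_ae ?_
  filter_upwards [h] with x hx
  by_cases hxs : x ∈ supp v
  · rw [indicator_of_mem hxs]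
  · rw [indicator_of_notMem hxs]
    have : v x = 0 := by simpa using hx hxs
    simp [this]

/-- The Pearson divergence of two densities on `supp v`. -/
lemma marginalCost_eq (hc : 0 < c) (hv : IsAdmissibleDensity c v)
    (hu : MemLp u 2 (volume.restrict (supp v)))
    (hu0 : ∀ᵐ x ∂volume.restrict (supp v), 0 ≤ u x) :
    marginalCost u v = ENNReal.ofReal (∫ x in supp v, (u x - v x) ^ 2 / v x) := by
  have := hv.isFiniteMeasure
  have hw := hv.isWeight hc
  rw [marginalCost, pearson, hv.densityMeasure_eq]
  set μ := volume.restrict (supp v)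
  have hum : AEMeasurable (fun x => ENNReal.ofReal (u x)) μ :=
    hu.aestronglyMeasurable.aemeasurable.ennreal_ofReal
  have hvm : AEMeasurable (fun x => ENNReal.ofReal (v x)) μ :=
    hw.aestronglyMeasurable.aemeasurable.ennreal_ofReal
  have hv0 : ∀ᵐ x ∂μ, ENNReal.ofReal (v x) ≠ 0 := by
    filter_upwards [hw.pos] with x hx
    simpa using hx
  have hvac := withDensity_absolutelyContinuous' hvm hv0
  have : IsFiniteMeasure (μ.withDensity fun x => ENNReal.ofReal (u x)) :=
    isFiniteMeasure_withDensity_ofReal (hu.integrable one_le_two).2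
  rw [if_pos ((withDensity_absolutelyContinuous _ _).trans hvac),
    lintegral_withDensity_eq_lintegral_mul₀ hvm (by fun_prop), ofReal_integral_eq_lintegral_ofReal]
  · refine lintegral_congr_ae ?_
    filter_upwards [Measure.rnDeriv_withDensity_right (μ.withDensity fun x => ENNReal.ofReal (u x))
      μ hvm hv0 (ae_of_all _ fun _ => ENNReal.ofReal_ne_top),
      Measure.rnDeriv_withDensity₀ μ hum, hw.pos, hu0] with x h1 h2 h3 h4
    rw [Pi.mul_apply, h1, h2, ← ENNReal.ofReal_mul h3.le, ENNReal.toReal_mul, ENNReal.toReal_inv,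
      ENNReal.toReal_ofReal h3.le, ENNReal.toReal_ofReal h4]
    congr 1
    field_simp
  · have hd : MemLp (fun x => u x - v x) 2 μ := hu.sub hw.memLp
    refine (hd.integrable_mul (hw.memLp_div hd)).congr (ae_of_all _ fun x => ?_)
    simp only [Pi.mul_apply]
    ring
  · filter_upwards [hw.pos] with x hx
    positivity

lemma integral_pearson_eq (hc : 0 < c) (hv : IsAdmissibleDensity c v)
    (hu : MemLp u 2 (volume.restrict (supp v))) (hk : MemLp k₁ 2 (volume.restrict (supp v))) :
    ∫ x in supp v, (u x - v x) ^ 2 / v x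
      = -2 * (∫ x in supp v, quadGain v (fun x => 1 - k₁ x) u x)
        - 2 * (∫ x in supp v, u x * k₁ x) + ∫ x in supp v, v x := by
  have := hv.isFiniteMeasure
  have hw := hv.isWeight hc
  have hs : MemLp (fun x => 1 - k₁ x) 2 (volume.restrict (supp v)) := (memLp_const 1).sub hk
  have i1 := (integrable_quadGain hw hs hu).const_mul (-2)
  have i2 := (hu.integrable_mul hk).const_mul 2
  have i3 := hw.memLp.integrable one_le_two
  have e1 := integral_add (i1.sub i2) i3
  have e2 := integral_sub i1 i2
  simp only [Pi.sub_apply, Pi.mul_apply] at e1 e2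
  rw [← integral_const_mul, ← integral_const_mul, ← e2, ← e1]
  refine integral_congr_ae ?_
  filter_upwards [hw.pos] with x hx
  simp only [quadGain]
  field_simp
  ring

/-- The conjugate of the Pearson penalty, with the maximizer given pointwise. -/
lemma conjF_eq (hc : 0 < c) (hv : IsAdmissibleDensity c v) (hθ : 0 ≤ θ)
    (hk : MemLp k₁ 2 (volume.restrict (supp v))) :
    conjF θ (fun x => -2 * k₁ x) v = ((2 * (∫ x in supp v,
      quadGain v (fun x => 1 - k₁ x) (quadArgmax θ v (fun x => 1 - k₁ x)) x)
        - ∫ x in supp v, v x : ℝ) : EReal) := by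
  have := hv.isFiniteMeasure
  have hw := hv.isWeight hc
  have hs : MemLp (fun x => 1 - k₁ x) 2 (volume.restrict (supp v)) := (memLp_const 1).sub hk
  have key (u : Space d → ℝ) (hu : u ∈ L2ge θ (supp v)) :
      ((∫ x in supp v, u x * (-2 * k₁ x) : ℝ) : EReal) - (marginalCost u v : EReal)
        = ((2 * (∫ x in supp v, quadGain v (fun x => 1 - k₁ x) u x)
          - ∫ x in supp v, v x : ℝ) : EReal) := by
    rw [marginalCost_eq hc hv hu.1 (hu.2.mono fun x hx => hθ.trans hx),
      coe_ennreal_ofReal_of_nonneg, ← EReal.coe_sub, integral_pearson_eq hc hv hu.1 hk]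
    · congr 1
      have : ∫ x in supp v, u x * (-2 * k₁ x) = -2 * ∫ x in supp v, u x * k₁ x := by
        rw [← integral_const_mul]
        congr with x
        ring
      rw [this]
      ring
    · refine integral_nonneg_of_ae ?_
      filter_upwards [hw.pos] with x hx
      simp only [Pi.zero_apply]
      positivity
  refine le_antisymm (iSup₂_le fun u hu => ?_) ?_
  · rw [key u hu, EReal.coe_le_coe_iff]
    have := integral_quadGain_le hw hs hu.1 hu.2
    linarith
  · have hm : quadArgmax θ v (fun x => 1 - k₁ x) ∈ L2ge θ (supp v) :=
      ⟨memLp_quadArgmax hw hs, ae_of_all _ fun x => le_max_left _ _⟩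
    rw [← key _ hm]
    exact le_iSup₂_of_le _ hm le_rfl

/-! ### The cost on the product of the supports -/

lemma restrict_Omega :
    (volume : Measure (Space d × Space d)).restrict (Omega f g)
      = (volume.restrict (supp f)).prod (volume.restrict (supp g)) := by
  rw [Measure.prod_restrict, ← Measure.volume_eq_prod, Omega]

lemma measurableSet_Omega : MeasurableSet (Omega f g) :=
  measurableSet_supp.prod measurableSet_supp

lemma isFiniteMeasure_Omega (hf : IsAdmissibleDensity c f) (hg : IsAdmissibleDensity c g) :
    IsFiniteMeasure (volume.restrict (Omega f g)) :=
  ⟨by simpa [Omega] using (hf.isCompact_supp.prod hg.isCompact_supp).measure_lt_top⟩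

/-- A locally Hölder cost that is finite on the compact set `Ω` is continuous, hence bounded,
there. -/
lemma memLp_cost (hf : IsAdmissibleDensity c f) (hg : IsAdmissibleDensity c g)
    (hC : IsLocallyHolder C) (hCfin : ∀ p ∈ Omega f g, C p ≠ ∞) :
    MemLp (fun p => (C p).toReal) 2 (volume.restrict (Omega f g)) := by
  have hcont : ContinuousOn (fun p => (C p).toReal) (Omega f g) := fun p hp => by
    obtain ⟨U, hU, L, α, hα, -, h⟩ := hC p (hCfin p hp)
    have h1 := h.continuousOn hα p ⟨mem_of_mem_nhds hU, hCfin p hp⟩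
    exact h1.mono_of_mem_nhdsWithin (Filter.inter_mem (mem_nhdsWithin_of_mem_nhds hU)
      (Filter.mem_of_superset self_mem_nhdsWithin hCfin))
  have := isFiniteMeasure_Omega hf hg
  obtain ⟨M, hM⟩ := (hf.isCompact_supp.prod hg.isCompact_supp).exists_bound_of_continuousOn hcont
  exact MemLp.of_bound (hcont.aestronglyMeasurable measurableSet_Omega) M
    ((ae_restrict_iff' measurableSet_Omega).2 (ae_of_all _ hM))

lemma transportCost_eq (hCfin : ∀ p ∈ Omega f g, C p ≠ ∞)
    (hCm : MemLp (fun p => (C p).toReal) 2 (volume.restrict (Omega f g)))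
    (hk : MemLp k 2 (volume.restrict (Omega f g)))
    (hk0 : ∀ᵐ p ∂volume.restrict (Omega f g), 0 ≤ k p) :
    transportCost C f g k = ENNReal.ofReal (∫ p in Omega f g, (C p).toReal * k p) := by
  have hint : Integrable (fun p => (C p).toReal * k p) (volume.restrict (Omega f g)) :=
    hCm.integrable_mul hk
  rw [transportCost, ofReal_integral_eq_lintegral_ofReal hint]
  · refine lintegral_congr_ae ?_
    filter_upwards [ae_restrict_mem measurableSet_Omega] with p hp
    rw [ENNReal.ofReal_mul ENNReal.toReal_nonneg, ENNReal.ofReal_toReal (hCfin p hp)]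
  · filter_upwards [hk0] with p hp
    simp only [Pi.zero_apply]
    positivity

lemma sqNorm_eq (hk : MemLp k 2 (volume.restrict (Omega f g))) :
    sqNorm f g k = ENNReal.ofReal (∫ p in Omega f g, k p ^ 2) := by
  rw [sqNorm, eLpNorm_eq_lintegral_rpow_enorm_toReal (by norm_num) (by norm_num),
    ofReal_integral_eq_lintegral_ofReal hk.integrable_sq (ae_of_all _ fun p => sq_nonneg _),
    ← ENNReal.rpow_natCast, ← ENNReal.rpow_mul]
  norm_num
  refine lintegral_congr fun p => ?_
  rw [← sq_abs, ENNReal.ofReal_pow (abs_nonneg _), Real.enorm_eq_ofReal_abs]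

lemma half_mul_ofReal (x : ℝ) :
    (1 / 2 : ℝ≥0∞) * ENNReal.ofReal x = ENNReal.ofReal (1 / 2 * x) := by
  rw [ENNReal.ofReal_mul (by norm_num), ENNReal.ofReal_div_of_pos (by norm_num)]
  norm_num

lemma integral_quadGain_one_eq
    (hCm : MemLp (fun p => (C p).toReal) 2 (volume.restrict (Omega f g)))
    (hk : MemLp k 2 (volume.restrict (Omega f g))) (hw : MemLp w 2 (volume.restrict (Omega f g))) :
    ∫ p in Omega f g, quadGain (fun _ => 1) (fun p => w p - (C p).toReal) k p
      = (∫ p in Omega f g, k p * w p) - (∫ p in Omega f g, (C p).toReal * k p)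
        - 1 / 2 * ∫ p in Omega f g, k p ^ 2 := by
  have i1 := hk.integrable_mul hw
  have i2 := hCm.integrable_mul hk
  have i3 := hk.integrable_sq.const_mul (1 / 2)
  have e1 := integral_sub (i1.sub i2) i3
  have e2 := integral_sub i1 i2
  simp only [Pi.sub_apply, Pi.mul_apply] at e1 e2
  rw [← integral_const_mul, ← e2, ← e1]
  congr with p
  simp only [quadGain]
  ring

/-- The conjugate of the transport cost with quadratic penalty, with the maximizer given
pointwise. -/
lemma conjC_eq (hf : IsAdmissibleDensity c f) (hg : IsAdmissibleDensity c g)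
    (hδ : 0 ≤ δ) (hCfin : ∀ p ∈ Omega f g, C p ≠ ∞)
    (hCm : MemLp (fun p => (C p).toReal) 2 (volume.restrict (Omega f g)))
    (hw : MemLp w 2 (volume.restrict (Omega f g))) :
    conjC δ C f g w = ((∫ p in Omega f g, quadGain (fun _ => 1) (fun p => w p - (C p).toReal)
      (quadArgmax δ (fun _ => 1) (fun p => w p - (C p).toReal)) p : ℝ) : EReal) := by
  have := isFiniteMeasure_Omega hf hg
  have hs : MemLp (fun p => w p - (C p).toReal) 2 (volume.restrict (Omega f g)) := hw.sub hCm
  have key (k : Space d × Space d → ℝ) (hk : k ∈ L2ge δ (Omega f g)) :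
      ((∫ p in Omega f g, k p * w p : ℝ) : EReal) - (transportCost C f g k : EReal)
        - ((1 / 2 * sqNorm f g k : ℝ≥0∞) : EReal)
      = ((∫ p in Omega f g, quadGain (fun _ => 1) (fun p => w p - (C p).toReal) k p : ℝ)
          : EReal) := by
    have hk0 := hk.2.mono fun p hp => hδ.trans hp
    rw [transportCost_eq hCfin hCm hk.1 hk0, sqNorm_eq hk.1, half_mul_ofReal,
      coe_ennreal_ofReal_of_nonneg, coe_ennreal_ofReal_of_nonneg, ← EReal.coe_sub,
      ← EReal.coe_sub, integral_quadGain_one_eq hCm hk.1 hw]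
    · positivity
    · refine integral_nonneg_of_ae ?_
      filter_upwards [hk0] with p hp
      simp only [Pi.zero_apply]
      positivity
  refine le_antisymm (iSup₂_le fun k hk => ?_) ?_
  · rw [key k hk, EReal.coe_le_coe_iff]
    exact integral_quadGain_le .one hs hk.1 hk.2
  · have hm : quadArgmax δ (fun _ => 1) (fun p => w p - (C p).toReal) ∈ L2ge δ (Omega f g) :=
      ⟨memLp_quadArgmax .one hs, ae_of_all _ fun x => le_max_left _ _⟩
    rw [← key _ hm]
    exact le_iSup₂_of_le _ hm le_rfl

end Formulas

/-! ### The duality gap -/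

section Duality

variable {d : ℕ} {c δ : ℝ} {f g k₁ k₂ : Space d → ℝ} {C : Space d × Space d → ℝ≥0∞}
  {k : Space d × Space d → ℝ}

/-- The optimality system, each equation saying that a maximum in one of the three conjugates is
attained. -/
def IsOptimal (δ : ℝ) (C : Space d × Space d → ℝ≥0∞) (f g : Space d → ℝ)
    (k : Space d × Space d → ℝ) (k₁ k₂ : Space d → ℝ) : Prop :=
  k =ᵐ[volume.restrict (Omega f g)]
      quadArgmax δ (fun _ => 1) (fun p => k₁ p.1 + k₂ p.2 - (C p).toReal) ∧
    marginalX g k =ᵐ[volume.restrict (supp f)]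
      quadArgmax (δ * volume.real (supp g)) f (fun x => 1 - k₁ x) ∧
    marginalY f k =ᵐ[volume.restrict (supp g)]
      quadArgmax (δ * volume.real (supp f)) g (fun y => 1 - k₂ y)

lemma isOptimal_iff (hc : 0 < c) (hf : IsAdmissibleDensity c f) (hg : IsAdmissibleDensity c g) :
    IsOptimal δ C f g k k₁ k₂ ↔
      (∀ᵐ p ∂(volume.restrict (Omega f g)), k p = max δ (k₁ p.1 + k₂ p.2 - (C p).toReal)) ∧
      (∀ᵐ x ∂(volume.restrict (supp f)),
        marginalX g k x = f x * max (δ * volume.real (supp g) / f x) (1 - k₁ x)) ∧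
      (∀ᵐ y ∂(volume.restrict (supp g)),
        marginalY f k y = g y * max (δ * volume.real (supp f) / g y) (1 - k₂ y)) := by
  have key {v : Space d → ℝ} (hv : IsAdmissibleDensity c v) (θ : ℝ) (s u : Space d → ℝ) :
      u =ᵐ[volume.restrict (supp v)] quadArgmax θ v s ↔
        ∀ᵐ x ∂(volume.restrict (supp v)), u x = v x * max (θ / v x) (s x) := by
    refine Filter.eventually_congr ?_
    filter_upwards [(hv.isWeight hc).pos] with x hx
    rw [mul_max_of_nonneg _ _ hx.le, mul_div_cancel₀ _ hx.ne', quadArgmax]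
  rw [IsOptimal, key hf, key hg]
  simp only [Filter.EventuallyEq, quadArgmax, one_mul]

lemma marginalX_mem (hf : IsAdmissibleDensity c f) (hg : IsAdmissibleDensity c g)
    (hk : k ∈ L2ge δ (Omega f g)) :
    marginalX g k ∈ L2ge (δ * volume.real (supp g)) (supp f) := by
  have := hf.isFiniteMeasure
  have := hg.isFiniteMeasure
  obtain ⟨h1, h2⟩ := hk
  rw [restrict_Omega] at h1 h2
  refine ⟨memLp_integral_snd h1, ?_⟩
  simpa [marginalX] using le_integral_snd (h1.integrable one_le_two) h2

lemma marginalY_mem (hf : IsAdmissibleDensity c f) (hg : IsAdmissibleDensity c g)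
    (hk : k ∈ L2ge δ (Omega f g)) :
    marginalY f k ∈ L2ge (δ * volume.real (supp f)) (supp g) := by
  have := hf.isFiniteMeasure
  have := hg.isFiniteMeasure
  obtain ⟨h1, h2⟩ := hk
  rw [restrict_Omega] at h1 h2
  refine ⟨memLp_integral_fst h1, ?_⟩
  simpa [marginalY] using le_integral_fst (h1.integrable one_le_two) h2

lemma memLp_add_Omega (hf : IsAdmissibleDensity c f) (hg : IsAdmissibleDensity c g)
    (hk₁ : MemLp k₁ 2 (volume.restrict (supp f))) (hk₂ : MemLp k₂ 2 (volume.restrict (supp g))) :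
    MemLp (fun p : Space d × Space d => k₁ p.1 + k₂ p.2) 2 (volume.restrict (Omega f g)) := by
  have := hf.isFiniteMeasure
  have := hg.isFiniteMeasure
  rw [restrict_Omega]
  exact (hk₁.comp_fst _).add (hk₂.comp_snd _)

/-- The pairing of `k` with `k₁ + k₂` splits into pairings with the marginals. -/
lemma integral_mul_add_Omega (hf : IsAdmissibleDensity c f) (hg : IsAdmissibleDensity c g)
    (hk : MemLp k 2 (volume.restrict (Omega f g)))
    (hk₁ : MemLp k₁ 2 (volume.restrict (supp f))) (hk₂ : MemLp k₂ 2 (volume.restrict (supp g))) :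
    ∫ p in Omega f g, k p * (k₁ p.1 + k₂ p.2)
      = (∫ x in supp f, marginalX g k x * k₁ x) + ∫ y in supp g, marginalY f k y * k₂ y := by
  have := hf.isFiniteMeasure
  have := hg.isFiniteMeasure
  rw [restrict_Omega] at hk ⊢
  have e1 := integral_mul_fst hk hk₁
  have e2 := integral_mul_snd hk hk₂
  simp only [marginalX, marginalY]
  rw [← e1, ← e2, ← integral_add]
  · simp only [mul_add]
  · exact hk.integrable_mul (hk₁.comp_fst _)
  · exact hk.integrable_mul (hk₂.comp_snd _)

/-- The primal objective, rewritten in terms of the concave quadratics whose maxima are the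
conjugates; the dual variables are arbitrary. -/
lemma coe_primalObjective_eq (hc : 0 < c) (hδ : 0 < δ)
    (hf : IsAdmissibleDensity c f) (hg : IsAdmissibleDensity c g)
    (hCfin : ∀ p ∈ Omega f g, C p ≠ ∞)
    (hCm : MemLp (fun p => (C p).toReal) 2 (volume.restrict (Omega f g)))
    (hk : k ∈ L2ge δ (Omega f g))
    (hk₁ : MemLp k₁ 2 (volume.restrict (supp f))) (hk₂ : MemLp k₂ 2 (volume.restrict (supp g))) :
    (primalObjective C f g k : EReal) =
      ((-(∫ p in Omega f g, quadGain (fun _ => 1)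
          (fun p => k₁ p.1 + k₂ p.2 - (C p).toReal) k p)
        - (∫ x in supp f, quadGain f (fun x => 1 - k₁ x) (marginalX g k) x)
        - (∫ y in supp g, quadGain g (fun y => 1 - k₂ y) (marginalY f k) y)
        + 1 / 2 * (∫ x in supp f, f x) + 1 / 2 * ∫ y in supp g, g y : ℝ) : EReal) := by
  have hX := marginalX_mem hf hg hk
  have hY := marginalY_mem hf hg hk
  have hk0 := hk.2.mono fun p hp => hδ.le.trans hp
  have hpos {v : Space d → ℝ} (hv : IsAdmissibleDensity c v) (u : Space d → ℝ) :
      0 ≤ ∫ x in supp v, (u x - v x) ^ 2 / v x := by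
    refine integral_nonneg_of_ae ?_
    filter_upwards [(hv.isWeight hc).pos] with x hx
    simp only [Pi.zero_apply]
    positivity
  have hCpos : 0 ≤ ∫ p in Omega f g, (C p).toReal * k p := by
    refine integral_nonneg_of_ae ?_
    filter_upwards [hk0] with p hp
    simp only [Pi.zero_apply]
    positivity
  have hXpos := hpos hf (marginalX g k)
  have hYpos := hpos hg (marginalY f k)
  rw [primalObjective, transportCost_eq hCfin hCm hk.1 hk0, sqNorm_eq hk.1,
    marginalCost_eq hc hf hX.1 (hX.2.mono fun x hx => le_trans (by positivity) hx),
    marginalCost_eq hc hg hY.1 (hY.2.mono fun x hx => le_trans (by positivity) hx),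
    half_mul_ofReal, half_mul_ofReal, half_mul_ofReal, ← ENNReal.ofReal_add hCpos (by positivity),
    ← ENNReal.ofReal_add (by positivity) (by positivity),
    ← ENNReal.ofReal_add (by positivity) (by positivity),
    coe_ennreal_ofReal_of_nonneg (by positivity),
    integral_quadGain_one_eq hCm hk.1 (memLp_add_Omega hf hg hk₁ hk₂),
    integral_mul_add_Omega hf hg hk.1 hk₁ hk₂, integral_pearson_eq hc hf hX.1 hk₁,
    integral_pearson_eq hc hg hY.1 hk₂]
  congr 1
  ring

lemma dualObjective_eq (hc : 0 < c) (hδ : 0 < δ)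
    (hf : IsAdmissibleDensity c f) (hg : IsAdmissibleDensity c g)
    (hCfin : ∀ p ∈ Omega f g, C p ≠ ∞)
    (hCm : MemLp (fun p => (C p).toReal) 2 (volume.restrict (Omega f g)))
    (hk₁ : MemLp k₁ 2 (volume.restrict (supp f))) (hk₂ : MemLp k₂ 2 (volume.restrict (supp g))) :
    dualObjective δ C f g (k₁, k₂) =
      (((∫ p in Omega f g, quadGain (fun _ => 1) (fun p => k₁ p.1 + k₂ p.2 - (C p).toReal)
          (quadArgmax δ (fun _ => 1) (fun p => k₁ p.1 + k₂ p.2 - (C p).toReal)) p)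
        + (∫ x in supp f, quadGain f (fun x => 1 - k₁ x)
          (quadArgmax (δ * volume.real (supp g)) f (fun x => 1 - k₁ x)) x)
        + (∫ y in supp g, quadGain g (fun y => 1 - k₂ y)
          (quadArgmax (δ * volume.real (supp f)) g (fun y => 1 - k₂ y)) y)
        - 1 / 2 * (∫ x in supp f, f x) - 1 / 2 * ∫ y in supp g, g y : ℝ) : EReal) := by
  rw [dualObjective, conjC_eq hf hg hδ.le hCfin hCm (memLp_add_Omega hf hg hk₁ hk₂),
    conjF_eq hc hf (by positivity) hk₁, conjF_eq hc hg (by positivity) hk₂, ← EReal.coe_mul,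
    ← EReal.coe_mul, ← EReal.coe_add, ← EReal.coe_add]
  congr 1
  ring

/-- Weak duality, with the equality case: the gap is a sum of three Fenchel–Young gaps. -/
lemma exists_real_objectives (hc : 0 < c) (hδ : 0 < δ)
    (hf : IsAdmissibleDensity c f) (hg : IsAdmissibleDensity c g)
    (hCfin : ∀ p ∈ Omega f g, C p ≠ ∞)
    (hCm : MemLp (fun p => (C p).toReal) 2 (volume.restrict (Omega f g)))
    (hk : k ∈ L2ge δ (Omega f g)) {q : (Space d → ℝ) × (Space d → ℝ)} (hq : q ∈ dualSpace f g) :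
    ∃ P D : ℝ, (primalObjective C f g k : EReal) = P ∧ dualObjective δ C f g q = D ∧
      0 ≤ P + D ∧ (P + D = 0 ↔ IsOptimal δ C f g k q.1 q.2) := by
  obtain ⟨k₁, k₂⟩ := q
  obtain ⟨hk₁, hk₂⟩ := hq
  have := hf.isFiniteMeasure
  have := hg.isFiniteMeasure
  have := isFiniteMeasure_Omega hf hg
  have hX := marginalX_mem hf hg hk
  have hY := marginalY_mem hf hg hk
  have hs : MemLp (fun p : Space d × Space d => k₁ p.1 + k₂ p.2 - (C p).toReal) 2
    (volume.restrict (Omega f g)) := (memLp_add_Omega hf hg hk₁ hk₂).sub hCm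
  have hs₁ : MemLp (fun x => 1 - k₁ x) 2 (volume.restrict (supp f)) := (memLp_const 1).sub hk₁
  have hs₂ : MemLp (fun x => 1 - k₂ x) 2 (volume.restrict (supp g)) := (memLp_const 1).sub hk₂
  have l0 := integral_quadGain_le .one hs hk.1 hk.2
  have l1 := integral_quadGain_le (hf.isWeight hc) hs₁ hX.1 hX.2
  have l2 := integral_quadGain_le (hg.isWeight hc) hs₂ hY.1 hY.2
  refine ⟨_, _, coe_primalObjective_eq hc hδ hf hg hCfin hCm hk hk₁ hk₂,
    dualObjective_eq hc hδ hf hg hCfin hCm hk₁ hk₂, by linarith, ?_⟩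
  rw [IsOptimal, ← integral_quadGain_eq_iff .one hs hk.1 hk.2,
    ← integral_quadGain_eq_iff (hf.isWeight hc) hs₁ hX.1 hX.2,
    ← integral_quadGain_eq_iff (hg.isWeight hc) hs₂ hY.1 hY.2]
  constructor
  · intro h
    refine ⟨?_, ?_, ?_⟩ <;> linarith
  · rintro ⟨h0, h1, h2⟩
    linarith

/-- A pair with vanishing duality gap is optimal in both problems. -/
lemma IsOptimal.isMinimizer (hc : 0 < c) (hδ : 0 < δ)
    (hf : IsAdmissibleDensity c f) (hg : IsAdmissibleDensity c g)
    (hCfin : ∀ p ∈ Omega f g, C p ≠ ∞)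
    (hCm : MemLp (fun p => (C p).toReal) 2 (volume.restrict (Omega f g)))
    (hk : k ∈ L2ge δ (Omega f g)) {q : (Space d → ℝ) × (Space d → ℝ)} (hq : q ∈ dualSpace f g)
    (hopt : IsOptimal δ C f g k q.1 q.2) :
    IsPrimalMinimizer δ C f g k ∧ IsDualMinimizer δ C f g q := by
  obtain ⟨P, D, hP, hD, -, h0⟩ := exists_real_objectives hc hδ hf hg hCfin hCm hk hq
  have hPD := h0.2 hopt
  refine ⟨⟨hk, fun h hh => ?_⟩, ⟨hq, fun r hr => ?_⟩⟩
  · obtain ⟨P', D', hP', hD', hnn, -⟩ := exists_real_objectives hc hδ hf hg hCfin hCm hh hq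
    have hDD : D = D' := EReal.coe_eq_coe_iff.1 (hD.symm.trans hD')
    rw [mem_ofPred_eq, ← EReal.coe_ennreal_le_coe_ennreal_iff, hP, hP', EReal.coe_le_coe_iff]
    linarith
  · obtain ⟨P', D', hP', hD', hnn, -⟩ := exists_real_objectives hc hδ hf hg hCfin hCm hk hr
    have hPP : P = P' := EReal.coe_eq_coe_iff.1 (hP.symm.trans hP')
    rw [mem_ofPred_eq, hD, hD', EReal.coe_le_coe_iff]
    linarith

lemma exists_isOptimal (hc : 0 < c)
    (hf : IsAdmissibleDensity c f) (hg : IsAdmissibleDensity c g)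
    (hCm : MemLp (fun p => (C p).toReal) 2 (volume.restrict (Omega f g))) :
    ∃ k ∈ L2ge δ (Omega f g), ∃ q ∈ dualSpace f g, IsOptimal δ C f g k q.1 q.2 := by
  have := hf.isFiniteMeasure
  have := hg.isFiniteMeasure
  have hwf := hf.isWeight hc
  have hwg := hg.isWeight hc
  obtain ⟨k, hk, hkδ, hopt⟩ := exists_eq_quadArgmax δ hwf hwg (by rwa [restrict_Omega] at hCm)
  rw [← restrict_Omega] at hk hkδ hopt
  have hX := marginalX_mem hf hg ⟨hk, hkδ⟩
  have hY := marginalY_mem hf hg ⟨hk, hkδ⟩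
  refine ⟨k, ⟨hk, hkδ⟩, (fun x => 1 - marginalX g k x / f x, fun y => 1 - marginalY f k y / g y),
    ⟨(memLp_const 1).sub (hwf.memLp_div hX.1), (memLp_const 1).sub (hwg.memLp_div hY.1)⟩,
    hopt, ?_, ?_⟩
  · filter_upwards [hwf.pos, hX.2] with x hx hle
    simp only [quadArgmax]
    rw [sub_sub_cancel, mul_div_cancel₀ _ hx.ne', max_eq_right hle]
  · filter_upwards [hwg.pos, hY.2] with y hy hle
    simp only [quadArgmax]
    rw [sub_sub_cancel, mul_div_cancel₀ _ hy.ne', max_eq_right hle]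

end Duality

end UOT

end

theorem mainTheorem3 (d : ℕ) (hd : 0 < d) (c δ : ℝ) (hc : 0 < c) (hδ : 0 < δ)
    (f g : UOT.Space d → ℝ)
    (hf : UOT.IsAdmissibleDensity c f) (hg : UOT.IsAdmissibleDensity c g)
    (hΩf : 0 < volume (UOT.supp f)) (hΩg : 0 < volume (UOT.supp g))
    (C : UOT.Space d × UOT.Space d → ℝ≥0∞)
    (hC : UOT.IsLocallyHolder C) (hCfin : ∀ p ∈ UOT.Omega f g, C p ≠ ∞) :
    (∃ k, UOT.IsPrimalMinimizer δ C f g k) ∧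
    (∃ q, UOT.IsDualMinimizer δ C f g q) ∧
    (∀ (k : UOT.Space d × UOT.Space d → ℝ) (k₁ k₂ : UOT.Space d → ℝ),
      MemLp k 2 (volume.restrict (UOT.Omega f g)) →
      MemLp k₁ 2 (volume.restrict (UOT.supp f)) →
      MemLp k₂ 2 (volume.restrict (UOT.supp g)) →
      ((UOT.IsPrimalMinimizer δ C f g k ∧ UOT.IsDualMinimizer δ C f g (k₁, k₂)) ↔
        ((∀ᵐ p ∂(volume.restrict (UOT.Omega f g)),
            k p = max δ (k₁ p.1 + k₂ p.2 - (C p).toReal)) ∧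
          (∀ᵐ x ∂(volume.restrict (UOT.supp f)),
            UOT.marginalX g k x
              = f x * max (δ * volume.real (UOT.supp g) / f x) (1 - k₁ x)) ∧
          (∀ᵐ y ∂(volume.restrict (UOT.supp g)),
            UOT.marginalY f k y
              = g y * max (δ * volume.real (UOT.supp f) / g y) (1 - k₂ y))))) ∧
    (UOT.primalValue δ C f g : EReal) + UOT.dualValue δ C f g = 0 := by
  have hCm := UOT.memLp_cost hf hg hC hCfin
  obtain ⟨k', hk', q', hq', hopt'⟩ := UOT.exists_isOptimal (δ := δ) hc hf hg hCm
  obtain ⟨hpm, hdm⟩ := hopt'.isMinimizer hc hδ hf hg hCfin hCm hk' hq'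
  obtain ⟨P', D', hP', hD', -, hgap'⟩ :=
    UOT.exists_real_objectives hc hδ hf hg hCfin hCm hk' hq'
  have hzero := hgap'.2 hopt'
  refine ⟨⟨k', hpm⟩, ⟨q', hdm⟩, fun k k₁ k₂ hk hk₁ hk₂ => ?_, ?_⟩
  · rw [← UOT.isOptimal_iff hc hf hg]
    constructor
    · rintro ⟨hkm, hqm⟩
      obtain ⟨P, D, hP, hD, -, hgap⟩ :=
        UOT.exists_real_objectives hc hδ hf hg hCfin hCm hkm.1 hqm.1
      have h1 : UOT.primalObjective C f g k = UOT.primalObjective C f g k' :=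
        le_antisymm (hkm.2 hk') (hpm.2 hkm.1)
      have h2 : UOT.dualObjective δ C f g (k₁, k₂) = UOT.dualObjective δ C f g q' :=
        le_antisymm (hqm.2 hq') (hdm.2 hqm.1)
      have h3 : P = P' := EReal.coe_eq_coe_iff.1 (by rw [← hP, ← hP', h1])
      have h4 : D = D' := EReal.coe_eq_coe_iff.1 (by rw [← hD, ← hD', h2])
      exact hgap.1 (by rw [h3, h4, hzero])
    · intro hopt
      have hkge : k ∈ UOT.L2ge δ (UOT.Omega f g) := by
        refine ⟨hk, ?_⟩
        filter_upwards [hopt.1] with p hp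
        rw [hp]
        exact le_max_left _ _
      exact hopt.isMinimizer hc hδ hf hg hCfin hCm hkge (q := (k₁, k₂)) ⟨hk₁, hk₂⟩
  · have h1 : UOT.primalValue δ C f g = UOT.primalObjective C f g k' :=
      le_antisymm (iInf₂_le k' hk') (le_iInf₂ fun h hh => hpm.2 hh)
    have h2 : UOT.dualValue δ C f g = UOT.dualObjective δ C f g q' :=
      le_antisymm (iInf₂_le q' hq') (le_iInf₂ fun r hr => hdm.2 hr)
    rw [h1, h2, hP', hD', ← EReal.coe_add, hzero, EReal.coe_zero]
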